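/- **Setting.** An *effect algebra* is a set $E$ with elements $0,1$ and a partial binary operation $\oplus$ such that: (E1) if $a\oplus b$ is defined, then $b\oplus a$ is defined and equal to it; (E2) if $a\oplus b$ and $(a\oplus b)\oplus c$ are defined, then so are $b\oplus c$ and $a\oplus(b\oplus c)$, and $(a\oplus b)\oplus c=a\oplus(b\oplus c)$; (E3) for each $a$ there is a unique $a'$ with $a\oplus a'=1$; (E4) if $a\oplus 1$ is defined, then $a=0$. Write $a\le b$ if $a\oplus c=b$ for some (unique) $c=:b\ominus a$; infima $\wedge$ refer to this order. Elements $a,b$ are *Mackey compatible*, $a\leftrightarrow b$, if $a=a_1\oplus c$, $b=b_1\oplus c$ for some $a_1,b_1,c$ such that $a_1\oplus b_1\oplus c$ exists. A map $\phi$ between effect algebras is *additive* if, whenever $a\oplus b$ is defined, so is $\phi(a)\oplus\phi(b)$, and $\phi(a\oplus b)=\phi(a)\oplus\phi(b)$. A *state* on $E$ is an additive map $s:E\to[0,1]\subset\mathbb R$ with $s(1)=1$, where in $[0,1]$ the sum $x\oplus y=x+y$ is defined iff $x+y\le 1$. A set $S$ of states is *separating* if $s(a)=s(b)$ for all $s\in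 S$ implies $a=b$. A *sub-effect algebra* is a subset containing $0,1$ and closed under $a\mapsto a'$ and under existing sums. A *compression* is an additive map $J:E\to E$ such that $a\le J(1)$ implies $J(a)=a$, and $J(a)=0\Leftrightarrow a\le J(1)'$. A *compression base* is a family $(J_p)_{p\in P}$ of compressions on $E$, indexed by a sub-effect algebra $P\subseteq E$, with $J_p(1)=p$, and such that for $p,q\in P$ with $p\leftrightarrow q$ (in $E$) one has $J_p\circ J_q=J_r$ for some $r\in P$. Elements of $P$ are called *projections*. Fix a compression base. For $p\in P$ put $C(p)=\{a\in E: a=J_p(a)\oplus J_{p'}(a)\}$; we say that $a$ and $p$ *commute* if $a\in C(p)$. For $A\subseteq E$ put $PC(A)=\{p\in P: A\subseteq C(p)\}$ and $P(A)=PC(PC(A)\cup A)$; write $P(a)=P(\{a\})$, $P(a,b)=P(\{a,b\})$. For $e,f\in E$ write $eCf$ if $p\leftrightarrow q$ for all $p\in P(e)$, $q\in P(f)$, and put $$P_\le(e,f)=\{p\in P(e,f): J_p(e)\le J_p(f),\ J_{p'}(f)\le J_{p'}(e)\}.$$ $E$ is *spectral* (with respect to the compression base) if 1. for every $a\in E$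 there is a sub-effect algebra $B(a)\subseteq P$ of $E$, which is a Boolean algebra with the inherited order and orthosupplement, such that for all $p\in P$: $a\in C(p)\Leftrightarrow B(a)\subseteq C(p)$; 2. $P_\le(e,f)\neq\emptyset$ whenever $eCf$; 3. every $a\in E$ has a *projection cover* $a^\circ\in P$, that is, for all $q\in P$: $a\le q\Leftrightarrow a^\circ\le q$. Let $E$ be spectral. If $eCf$, put $(f-e)_+:=J_p(f)\ominus J_p(e)$ for any $p\in P_\le(e,f)$ (this does not depend on $p$). Let $\mathcal B$ be the set of all finite binary strings (including the empty string $\varepsilon$), $l(w)$ the length of $w=w_1\dots w_{l(w)}$, and $\lambda(w)=\sum_{j=1}^{l(w)}w_j2^{-j}$. For $a\in E$ define $u_w,c_w$ for $w\in\mathcal B$ recursively by $u_\varepsilon=a^\circ$, $c_\varepsilon=a$ and $$u_{w0}=\big(((c_w-c_w')_+)^\circ\big)'\wedge u_w,\qquad u_{w1}=u_w\wedge u_{w0}',$$ $$c_{w0}=u_{w0}\ominus\big[(c_w'-c_w)_+\wedge u_w\big],\qquad c_{w1}=(c_w-c_w')_+\wedge u_w .$$ The *binary spectral resolution* of $a$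 is the family of *binary spectral projections* $p_{a,\lambda}$, indexed by the dyadic rationals $\lambda\in[0,1]$: $p_{a,0}=(a^\circ)'$, $p_{a,1}=1$, and for $w\in\mathcal B$ (every dyadic rational in $(0,1)$ is $\lambda(w1)$ for exactly one $w$) $$p_{a,\lambda(w1)}=(a^\circ)'\oplus\bigoplus_{v\in\{0,1\}^{l(w)+1},\ v\le w0}u_v,$$ with $\le$ on strings the lexicographic order. **Theorem.** Let $E$ be an effect algebra with a compression base $(J_p)_{p\in P}$ with respect to which $E$ is spectral, and assume that $E$ has a separating set of states. Then (i) for $q\in P$ and $a\in E$: $a\in C(q)$ if and only if $p_{a,\lambda(w)}\in C(q)$ for all $w\in\mathcal B$; (ii) if $a,b\in E$ satisfy $p_{a,\lambda(w)}=p_{b,\lambda(w)}$ for all $w\in\mathcal B$, then $a=b$. -/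

import Mathlib

/-- An effect algebra `(E; ⊕, 0, 1)`. The partial operation is `oadd`: `oadd a b = some c` means
that `a ⊕ b` is defined and equal to `c`, and `oadd a b = none` that `a ⊕ b` is undefined. -/
class EffectAlgebra (E : Type*) extends Zero E, One E where
  oadd : E → E → Option E
  oadd_comm : ∀ a b c : E, oadd a b = some c → oadd b a = some c
  oadd_assoc : ∀ a b c s t : E, oadd a b = some s → oadd s c = some t →
    ∃ r, oadd b c = some r ∧ oadd a r = some t
  existsUnique_orthosupp : ∀ a : E, ∃! a' : E, oadd a a' = some 1
  eq_zero_of_oadd_one : ∀ a c : E, oadd a 1 = some c → a = 0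

namespace EffectAlgebra

/-- The real unit interval with the partial sum `a ⊕ b = a + b`, defined when `a + b ≤ 1`. -/
noncomputable instance unitIntervalEffectAlgebra : EffectAlgebra unitInterval where
  oadd a b := if h : (a : ℝ) + b ≤ 1 then some ⟨a + b, add_nonneg a.2.1 b.2.1, h⟩ else none
  oadd_comm a b c h := by
    split_ifs at h with h1
    simp only [Option.some.injEq] at h
    subst h
    simp [h1, add_comm (b : ℝ) a]
  oadd_assoc a b c s t h1 h2 := by
    split_ifs at h1 with k1
    split_ifs at h2 with k2
    simp only [Option.some.injEq] at h1 h2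
    subst h1
    subst h2
    simp only at k2
    have k3 : (b : ℝ) + c ≤ 1 := by linarith [a.2.1]
    refine ⟨⟨b + c, add_nonneg b.2.1 c.2.1, k3⟩, by simp [k3], ?_⟩
    have k4 : (a : ℝ) + (b + c) ≤ 1 := by linarith
    simp [k4, add_assoc]
  existsUnique_orthosupp a := by
    refine ⟨⟨1 - a, by linarith [a.2.2], by linarith [a.2.1]⟩, ?_, ?_⟩
    · simp
    · intro y hy
      split_ifs at hy with k
      have := congrArg Subtype.val (Option.some.inj hy)
      apply Subtype.ext
      simp only [Set.Icc.coe_one] at this ⊢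
      linarith
  eq_zero_of_oadd_one a c h := by
    split_ifs at h with k
    apply Subtype.ext
    simp only [Set.Icc.coe_one, Set.Icc.coe_zero] at k ⊢
    linarith [a.2.1]

section Basic

variable {E : Type*} [EffectAlgebra E]

/-- The orthosupplement `a'`. -/
noncomputable def orthosupp (a : E) : E := (existsUnique_orthosupp a).choose

/-- The order of an effect algebra. -/
def Le (a b : E) : Prop := ∃ c, oadd a c = some b

/-- `m` is the infimum `a ∧ b` with respect to the order of the effect algebra. -/
def IsMeet (a b m : E) : Prop := Le m a ∧ Le m b ∧ ∀ x, Le x a → Le x b → Le x m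

/-- The infimum `a ∧ b`; meaningful when it exists. -/
noncomputable def meet (a b : E) : E :=
  haveI : Nonempty E := ⟨0⟩
  Classical.epsilon fun m => IsMeet a b m

/-- The difference `b ⊖ a`, the element `c` with `a ⊕ c = b`; meaningful when `a ≤ b`. -/
noncomputable def ominus (b a : E) : E :=
  haveI : Nonempty E := ⟨0⟩
  Classical.epsilon fun c => oadd a c = some b

/-- The finite orthosum `a₁ ⊕ ⋯ ⊕ aₙ` of a list, `none` if it is not defined. -/
def osum (l : List E) : Option E := l.foldr (fun a s => s.bind (oadd a)) (some 0)

/-- `a` and `b` are Mackey compatible: `a = a₁ ⊕ c`, `b = b₁ ⊕ c` for some `a₁, b₁, c` such that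
`a₁ ⊕ b₁ ⊕ c` exists. -/
def Mackey (a b : E) : Prop :=
  ∃ a₁ b₁ c s t : E, oadd a₁ b₁ = some s ∧ oadd s c = some t ∧
    oadd a₁ c = some a ∧ oadd b₁ c = some b

/-- Sub-effect algebras. -/
structure IsSubEffectAlgebra (F : Set E) : Prop where
  zero_mem : (0 : E) ∈ F
  one_mem : (1 : E) ∈ F
  orthosupp_mem : ∀ a ∈ F, orthosupp a ∈ F
  oadd_mem : ∀ a ∈ F, ∀ b ∈ F, ∀ c, oadd a b = some c → c ∈ F

/-- A sub-effect algebra of `E` which is a Boolean algebra in the order and with the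
orthosupplement inherited from `E`. -/
def IsBooleanSubalgebra (F : Set E) : Prop :=
  IsSubEffectAlgebra F ∧ ∃ _ : BooleanAlgebra F,
    (∀ x y : F, x ≤ y ↔ Le (x : E) (y : E)) ∧ ∀ x : F, ((xᶜ : F) : E) = orthosupp (x : E)

/-- Additive maps between effect algebras. -/
def IsAdditive {F : Type*} [EffectAlgebra F] (φ : E → F) : Prop :=
  ∀ a b c, oadd a b = some c → oadd (φ a) (φ b) = some (φ c)

/-- Morphisms of effect algebras. -/
def IsMorphism {F : Type*} [EffectAlgebra F] (φ : E → F) : Prop :=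
  IsAdditive φ ∧ φ 1 = 1

/-- A retraction: an additive map `J` with `J a = a` for all `a ≤ J 1`. -/
def IsRetraction (J : E → E) : Prop :=
  IsAdditive J ∧ ∀ a, Le a (J 1) → J a = a

/-- A compression: a retraction `J` with focus `p = J 1` such that `J a = 0` iff `a ≤ p'`. -/
def IsCompression (J : E → E) : Prop :=
  IsRetraction J ∧ ∀ a, J a = 0 ↔ Le a (orthosupp (J 1))

variable (E) in
/-- A state: a morphism into the real unit interval. -/
def State : Type _ := {s : E → unitInterval // IsMorphism s}

/-- A separating set of states. -/
def IsSeparating (S : Set (State E)) : Prop :=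
  ∀ a b : E, (∀ s ∈ S, s.1 a = s.1 b) → a = b

end Basic

/-- A compression base `(J_p)_{p ∈ P}`, indexed by a sub-effect algebra `P = proj`, whose elements
are called projections. -/
structure CompressionBase (E : Type*) [EffectAlgebra E] where
  proj : Set E
  isSubEffectAlgebra : IsSubEffectAlgebra proj
  J : proj → E → E
  isCompression : ∀ p, IsCompression (J p)
  focus : ∀ p, J p 1 = p
  comp_of_mackey : ∀ p q : proj, Mackey (p : E) (q : E) → ∃ r : proj, J p ∘ J q = J r

namespace CompressionBase

variable {E : Type*} [EffectAlgebra E] (B : CompressionBase E)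

/-- The projection `p'`, for a projection `p`. -/
noncomputable def pcompl (p : B.proj) : B.proj :=
  ⟨orthosupp (p : E), B.isSubEffectAlgebra.orthosupp_mem p p.2⟩

/-- The commutant `C(p) = {a | a = J_p(a) ⊕ J_{p'}(a)}`. -/
def commutant (p : B.proj) : Set E := {a | oadd (B.J p a) (B.J (B.pcompl p) a) = some a}

/-- `PC(A)`: the projections that commute with all elements of `A`. -/
def PC (A : Set E) : Set B.proj := {p | ∀ a ∈ A, a ∈ B.commutant p}

/-- The bicommutant `P(A) = PC(PC(A) ∪ A)`. -/
def bicommutant (A : Set E) : Set B.proj := B.PC (((↑) '' B.PC A) ∪ A)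

/-- `e C f`: every element of `P(e)` is Mackey compatible with every element of `P(f)`. -/
def Commute (e f : E) : Prop :=
  ∀ p ∈ B.bicommutant {e}, ∀ q ∈ B.bicommutant {f}, Mackey (p : E) (q : E)

/-- `p` is a projection cover of `a`. -/
def IsProjCover (a : E) (p : B.proj) : Prop := ∀ q : B.proj, Le a (q : E) ↔ Le (p : E) (q : E)

/-- The projection cover property. -/
def HasProjCover : Prop := ∀ a, ∃ p, B.IsProjCover a p

/-- The b-property. -/
def HasBProperty : Prop :=
  ∀ a : E, ∃ F : Set E, F ⊆ B.proj ∧ IsBooleanSubalgebra F ∧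
    ∀ p : B.proj, a ∈ B.commutant p ↔ F ⊆ B.commutant p

/-- `P_≤(e, f)`: the projections `p` in `P(e, f)` with `J_p(e) ≤ J_p(f)` and
`J_{p'}(f) ≤ J_{p'}(e)`. -/
def PLe (e f : E) : Set B.proj :=
  {p | p ∈ B.bicommutant {e, f} ∧ Le (B.J p e) (B.J p f) ∧
    Le (B.J (B.pcompl p) f) (B.J (B.pcompl p) e)}

/-- The b-comparability property. -/
def HasBComparability : Prop :=
  B.HasBProperty ∧ ∀ e f : E, B.Commute e f → (B.PLe e f).Nonempty

/-- `E` is spectral with respect to the compression base. -/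
def IsSpectral : Prop := B.HasBComparability ∧ B.HasProjCover

/-- The projection cover `a°`; meaningful when it exists. -/
noncomputable def cover (a : E) : B.proj :=
  haveI : Nonempty B.proj := ⟨0, B.isSubEffectAlgebra.zero_mem⟩
  Classical.epsilon fun p => B.IsProjCover a p

/-- The positive part `(b - a)₊ = J_p(b) ⊖ J_p(a)` for any `p ∈ P_≤(a, b)`; meaningful when
`P_≤(a, b)` is nonempty, and then independent of `p`. -/
noncomputable def posPart (b a : E) : E :=
  haveI : Nonempty E := ⟨0⟩
  Classical.epsilon fun x => ∃ p ∈ B.PLe a b, oadd (B.J p a) x = some (B.J p b)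

/-- `u_{w0} = ((c_w - c_w')₊°)' ∧ u_w` in terms of `u = u_w`, `c = c_w`. -/
noncomputable def nextU0 (u c : E) : E :=
  meet (orthosupp (B.cover (B.posPart c (orthosupp c)) : E)) u

/-- One step `(u_w, c_w) ↦ (u_{wi}, c_{wi})`, with the digit `i` given as a Boolean:
`u_{w1} = u_w ∧ u_{w0}'`, `c_{w1} = (c_w - c_w')₊ ∧ u_w`,
`c_{w0} = u_{w0} ⊖ [(c_w' - c_w)₊ ∧ u_w]`. -/
noncomputable def step (x : E × E) (i : Bool) : E × E :=
  let u := x.1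
  let c := x.2
  if i then
    (meet u (orthosupp (B.nextU0 u c)), meet (B.posPart c (orthosupp c)) u)
  else
    (B.nextU0 u c, ominus (B.nextU0 u c) (meet (B.posPart (orthosupp c) c) u))

/-- The pair `(u_w, c_w)` attached to `a` and the binary string `w`, with `u_ε = a°`, `c_ε = a`. -/
noncomputable def family (a : E) (w : List Bool) : E × E :=
  w.foldl B.step ((B.cover a : E), a)

/-- The projection `u_w` attached to `a`. -/
noncomputable def u (a : E) (w : List Bool) : E := (B.family a w).1

end CompressionBase

/-- `λ(w) = k(w) / 2^{l(w)}`, where `k(w)` is the natural number with binary digits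
`w₁ … w_{l(w)}`, most significant first. -/
def dyadic (w : List Bool) : ℚ :=
  (Nat.ofDigits 2 (w.reverse.map Bool.toNat) : ℚ) / 2 ^ w.length

/-- The list of all binary strings of length `n`, each occurring once. -/
def strings : ℕ → List (List Bool)
  | 0 => [[]]
  | n + 1 => (strings n).flatMap fun w => [w ++ [false], w ++ [true]]

namespace CompressionBase

variable {E : Type*} [EffectAlgebra E] (B : CompressionBase E)

/-- `(a°)' ⊕ ⨁ u_v`, the sum over the strings `v` of length `l(w) + 1` with `v ≤ w0`
in the lexicographic order. -/
noncomputable def specSum (a : E) (w : List Bool) : E :=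
  (osum (orthosupp (B.cover a : E) ::
    ((strings (w.length + 1)).filter fun v => decide (v ≤ w ++ [false])).map (B.u a))).getD 0

open Classical in
/-- The binary spectral resolution `(p_{a,t})` of `a`, where `t` runs through the dyadic rationals
in `[0, 1]`: `p_{a,0} = (a°)'`, `p_{a,1} = 1`, and, since every dyadic `t` in `(0, 1)` is `λ(w1)`
for exactly one `w`, `p_{a,t}` is `specSum a w` for this `w`. (Other values of `t` are not used.) -/
noncomputable def specProj (a : E) (t : ℚ) : E :=
  if t = 0 then orthosupp (B.cover a : E)
  else if h : ∃ w : List Bool, t = dyadic (w ++ [true]) then B.specSum a h.choose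
  else 1

end CompressionBase

end EffectAlgebra

/-! States reduce both claims to real numbers. For every nonnegative additive functional φ, the
recursion gives φ(J_{u_w}(a)) = λ(w) φ(u_w) + 2^{-l(w)} φ(c_w) (`family_spec`). Since c_w ≤ u_w and
the u_w with l(w) = n sum to a°, the sum of λ(w) φ(u_w) over these w is within 2^{-n} φ(a°) of φ(a)
(`functional_bounds`). So the numbers φ(u_w) determine φ(a), and they are recovered from the values
of φ at 1 and on the spectral projections (`map_u_eq`).

The resulting criterion `functional_eq_of_specProj` compares two functionals on two elements, so it
serves both claims. For (ii), use one state s twice. For (i), if the spectral projections of a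
commute with q, then s and s∘J_q + s∘J_{q'} agree on them, hence on a, and separation yields a =
J_q(a) ⊕ J_{q'}(a). The converse needs no states: if a lies in C(q), so do all u_w and c_w. -/

namespace EffectAlgebra

/-! ### Order, cancellation, finite sums and functionals -/

section Basic

variable {E : Type*} [EffectAlgebra E] {a b c d s t : E}

theorem oadd_orthosupp (a : E) : oadd a (orthosupp a) = some 1 :=
  (existsUnique_orthosupp a).choose_spec.1

theorem eq_orthosupp_of_oadd (h : oadd a b = some 1) : b = orthosupp a :=
  (existsUnique_orthosupp a).choose_spec.2 b h

theorem orthosupp_orthosupp (a : E) : orthosupp (orthosupp a) = a :=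
  (eq_orthosupp_of_oadd (oadd_comm _ _ _ (oadd_orthosupp a))).symm

theorem orthosupp_one : orthosupp (1 : E) = 0 :=
  eq_zero_of_oadd_one _ _ (oadd_comm _ _ _ (oadd_orthosupp (1 : E)))

theorem oadd_zero (a : E) : oadd a 0 = some a := by
  have h1 := oadd_orthosupp (1 : E)
  rw [orthosupp_one] at h1
  obtain ⟨r, hr, hr'⟩ := oadd_assoc _ _ _ _ _ (oadd_orthosupp (orthosupp a)) h1
  rw [orthosupp_orthosupp] at hr
  rwa [eq_orthosupp_of_oadd hr', orthosupp_orthosupp] at hr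

theorem zero_oadd (a : E) : oadd 0 a = some a := oadd_comm _ _ _ (oadd_zero a)

/-- The reversed form of associativity. -/
theorem oadd_assoc_symm (h1 : oadd b c = some s) (h2 : oadd a s = some t) :
    ∃ r, oadd a b = some r ∧ oadd r c = some t := by
  obtain ⟨r, hr, hr'⟩ := oadd_assoc _ _ _ _ _ (oadd_comm _ _ _ h1) (oadd_comm _ _ _ h2)
  exact ⟨r, oadd_comm _ _ _ hr, oadd_comm _ _ _ hr'⟩

/-- If a ⊕ x = s, then x ⊕ (a ⊕ s') = 1, so x' = s' ⊕ a depends on a and s only. -/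
theorem oadd_left_cancel (h1 : oadd a b = some s) (h2 : oadd a c = some s) : b = c := by
  have key : ∀ x, oadd a x = some s → oadd (orthosupp s) a = some (orthosupp x) := by
    intro x hx
    obtain ⟨r, hr, hr'⟩ := oadd_assoc _ _ _ _ _ (oadd_comm _ _ _ hx) (oadd_orthosupp s)
    rw [eq_orthosupp_of_oadd hr'] at hr
    exact oadd_comm _ _ _ hr
  have := (key b h1).symm.trans (key c h2)
  rw [← orthosupp_orthosupp b, Option.some.inj this, orthosupp_orthosupp]

theorem eq_zero_of_oadd_eq_zero (h : oadd a b = some 0) : a = 0 := by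
  obtain ⟨r, hr, -⟩ := oadd_assoc _ _ _ _ _ (oadd_comm _ _ _ h) (zero_oadd 1)
  exact eq_zero_of_oadd_one _ _ hr

theorem le_rfl' (a : E) : Le a a := ⟨0, oadd_zero a⟩

theorem zero_le' (a : E) : Le 0 a := ⟨a, zero_oadd a⟩

theorem le_one' (a : E) : Le a 1 := ⟨_, oadd_orthosupp a⟩

theorem Le.trans (h1 : Le a b) (h2 : Le b c) : Le a c := by
  obtain ⟨x, hx⟩ := h1
  obtain ⟨y, hy⟩ := h2
  obtain ⟨r, -, hr⟩ := oadd_assoc _ _ _ _ _ hx hy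
  exact ⟨r, hr⟩

theorem Le.antisymm (h1 : Le a b) (h2 : Le b a) : a = b := by
  obtain ⟨x, hx⟩ := h1
  obtain ⟨y, hy⟩ := h2
  obtain ⟨r, hr, hr'⟩ := oadd_assoc _ _ _ _ _ hx hy
  have := oadd_left_cancel hr' (oadd_zero a)
  subst this
  rw [eq_zero_of_oadd_eq_zero hr, oadd_zero] at hx
  exact Option.some.inj hx

theorem le_left_of_oadd (h : oadd a b = some c) : Le a c := ⟨b, h⟩

theorem le_right_of_oadd (h : oadd a b = some c) : Le b c := ⟨a, oadd_comm _ _ _ h⟩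

theorem le_orthosupp_of_oadd (h : oadd a b = some s) : Le a (orthosupp b) := by
  obtain ⟨r, hr, hr'⟩ := oadd_assoc _ _ _ _ _ (oadd_comm _ _ _ h) (oadd_orthosupp s)
  rw [eq_orthosupp_of_oadd hr'] at hr
  exact ⟨_, hr⟩

theorem exists_oadd_of_le_orthosupp (h : Le a (orthosupp b)) : ∃ s, oadd a b = some s := by
  obtain ⟨x, hx⟩ := h
  obtain ⟨r, hr, -⟩ := oadd_assoc _ _ _ _ _ (oadd_comm _ _ _ hx)
    (oadd_comm _ _ _ (oadd_orthosupp b))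
  exact ⟨r, hr⟩

theorem le_orthosupp_comm (h : Le a (orthosupp b)) : Le b (orthosupp a) := by
  obtain ⟨s, hs⟩ := exists_oadd_of_le_orthosupp h
  exact le_orthosupp_of_oadd (oadd_comm _ _ _ hs)

theorem orthosupp_antitone (h : Le a b) : Le (orthosupp b) (orthosupp a) :=
  le_orthosupp_comm (by rwa [orthosupp_orthosupp])

theorem exists_oadd_of_le (h1 : Le a c) (h2 : Le b (orthosupp c)) : ∃ s, oadd a b = some s :=
  exists_oadd_of_le_orthosupp (h1.trans (le_orthosupp_comm h2))

/-- Sums of four elements may be rearranged. -/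
theorem oadd_oadd_oadd_comm {a₁ a₂ x₁ x₂ b₁ b₂ : E} (h1 : oadd a₁ x₁ = some b₁)
    (h2 : oadd a₂ x₂ = some b₂) (h : oadd b₁ b₂ = some b) :
    ∃ a x, oadd a₁ a₂ = some a ∧ oadd x₁ x₂ = some x ∧ oadd a x = some b := by
  obtain ⟨r, hr, hr'⟩ := oadd_assoc _ _ _ _ _ h1 h
  obtain ⟨k, hk, hk'⟩ := oadd_assoc_symm (oadd_comm _ _ _ h2) hr
  obtain ⟨a, ha, ha'⟩ := oadd_assoc_symm (oadd_comm _ _ _ hk') hr'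
  exact ⟨a, k, ha, hk, ha'⟩

theorem IsMeet.meet_eq {m : E} (h : IsMeet a b m) : meet a b = m := by
  have hm : IsMeet a b (meet a b) :=
    @Classical.epsilon_spec E (fun m => IsMeet a b m) ⟨m, h⟩
  exact (h.2.2 _ hm.1 hm.2.1).antisymm (hm.2.2 _ h.1 h.2.1)

theorem ominus_eq (h : oadd a c = some b) : ominus b a = c :=
  oadd_left_cancel (@Classical.epsilon_spec E (fun c => oadd a c = some b) ⟨c, h⟩) h

theorem osum_cons_eq_some {x : E} {l : List E} :
    osum (x :: l) = some s ↔ ∃ t, osum l = some t ∧ oadd x t = some s := by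
  change (osum l).bind (oadd x) = some s ↔ _
  exact Option.bind_eq_some_iff

theorem osum_sublist {l' l : List E} (h : l'.Sublist l) :
    ∀ {s : E}, osum l = some s → ∃ s', osum l' = some s' ∧ Le s' s := by
  induction h with
  | slnil => exact fun h => ⟨_, h, le_rfl' _⟩
  | cons x _ ih =>
    intro s hs
    obtain ⟨t, ht, hts⟩ := osum_cons_eq_some.1 hs
    obtain ⟨s', hs', hle⟩ := ih ht
    exact ⟨s', hs', hle.trans (le_right_of_oadd hts)⟩
  | cons_cons x _ ih =>
    intro s hs
    obtain ⟨t, ht, hts⟩ := osum_cons_eq_some.1 hs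
    obtain ⟨s', hs', y, hy⟩ := ih ht
    obtain ⟨r, hr, hr'⟩ := oadd_assoc_symm hy hts
    exact ⟨r, osum_cons_eq_some.2 ⟨s', hs', hr⟩, le_left_of_oadd hr'⟩

theorem osum_flatMap_pair {α : Type*} {f g₀ g₁ : α → E}
    (h : ∀ w, oadd (g₀ w) (g₁ w) = some (f w)) (l : List α) :
    ∀ {s : E}, osum (l.map f) = some s → osum (l.flatMap fun w => [g₀ w, g₁ w]) = some s := by
  induction l with
  | nil => exact fun h => h
  | cons w l ih =>
    intro s hs
    obtain ⟨t, ht, hts⟩ := osum_cons_eq_some.1 hs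
    obtain ⟨r, hr, hr'⟩ := oadd_assoc _ _ _ _ _ (h w) hts
    exact osum_cons_eq_some.2 ⟨r, osum_cons_eq_some.2 ⟨t, ih ht, hr⟩, hr'⟩

/-- A nonnegative real-valued additive functional on an effect algebra. -/
structure IsFunctional (φ : E → ℝ) : Prop where
  add : ∀ {a b c : E}, oadd a b = some c → φ a + φ b = φ c
  nonneg : ∀ a, 0 ≤ φ a

theorem IsFunctional.map_zero {φ : E → ℝ} (hφ : IsFunctional φ) : φ 0 = 0 := by
  have := hφ.add (oadd_zero (0 : E))
  linarith

theorem IsFunctional.mono {φ : E → ℝ} (hφ : IsFunctional φ) (h : Le a b) : φ a ≤ φ b := by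
  obtain ⟨x, hx⟩ := h
  have := hφ.add hx
  linarith [hφ.nonneg x]

theorem IsFunctional.map_osum {φ : E → ℝ} (hφ : IsFunctional φ) (l : List E) :
    ∀ {s : E}, osum l = some s → φ s = (l.map φ).sum := by
  induction l with
  | nil =>
    intro s hs
    cases hs
    simpa using hφ.map_zero
  | cons x l ih =>
    intro s hs
    obtain ⟨t, ht, hts⟩ := osum_cons_eq_some.1 hs
    rw [List.map_cons, List.sum_cons, ← ih ht, hφ.add hts]

theorem State.isFunctional (s : State E) : IsFunctional fun a => (s.1 a : ℝ) where
  add {a b c} h := by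
    have h1 := s.2.1 a b c h
    change (if h : ((s.1 a : ℝ)) + s.1 b ≤ 1 then some (⟨_, _⟩ : unitInterval) else none) = _ at h1
    split_ifs at h1 with k
    exact congrArg Subtype.val (Option.some.inj h1)
  nonneg a := (s.1 a).2.1

end Basic

/-! ### Compressions and commutants -/

namespace CompressionBase

variable {E : Type*} [EffectAlgebra E] (B : CompressionBase E) {p q r : B.proj} {a b c x : E}

theorem coe_pcompl (p : B.proj) : ((B.pcompl p : B.proj) : E) = orthosupp (p : E) := rfl

theorem pcompl_pcompl (p : B.proj) : B.pcompl (B.pcompl p) = p :=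
  Subtype.ext (orthosupp_orthosupp _)

theorem J_oadd (p : B.proj) (h : oadd a b = some c) :
    oadd (B.J p a) (B.J p b) = some (B.J p c) :=
  (B.isCompression p).1.1 _ _ _ h

theorem J_mono (p : B.proj) (h : Le a b) : Le (B.J p a) (B.J p b) := by
  obtain ⟨x, hx⟩ := h
  exact ⟨_, B.J_oadd p hx⟩

theorem J_le (p : B.proj) (a : E) : Le (B.J p a) p := by
  have := B.J_mono p (le_one' a)
  rwa [B.focus] at this

theorem J_of_le (h : Le a p) : B.J p a = a :=
  (B.isCompression p).1.2 a (by rwa [B.focus])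

theorem J_eq_zero_iff : B.J p a = 0 ↔ Le a (orthosupp (p : E)) := by
  rw [(B.isCompression p).2, B.focus]

theorem J_pcompl_eq_zero_iff : B.J (B.pcompl p) a = 0 ↔ Le a p := by
  rw [B.J_eq_zero_iff, coe_pcompl, orthosupp_orthosupp]

/-- Projections are principal. -/
theorem oadd_le (h : oadd a b = some c) (ha : Le a p) (hb : Le b p) : Le c p := by
  have h1 := B.J_oadd p h
  rw [B.J_of_le ha, B.J_of_le hb, h] at h1
  rw [Option.some.inj h1]
  exact B.J_le p c

/-- J_p fixes a and kills b, and J_{p'} does the reverse, so any splitting of c along p and p' is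
the one given by the compressions. -/
theorem mem_commutant_of_oadd (h : oadd a b = some c) (ha : Le a p)
    (hb : Le b (orthosupp (p : E))) : c ∈ B.commutant p := by
  have h1 := B.J_oadd p h
  have h2 := B.J_oadd (B.pcompl p) h
  rw [B.J_of_le ha, B.J_eq_zero_iff.2 hb, oadd_zero] at h1
  rw [B.J_of_le (p := B.pcompl p) hb, B.J_pcompl_eq_zero_iff.2 ha, zero_oadd] at h2
  change oadd _ _ = some c
  rwa [← Option.some.inj h1, ← Option.some.inj h2]

theorem mem_commutant_of_le (h : Le a p) : a ∈ B.commutant p :=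
  B.mem_commutant_of_oadd (oadd_zero a) h (zero_le' _)

theorem mem_commutant_pcompl (h : a ∈ B.commutant p) : a ∈ B.commutant (B.pcompl p) := by
  change oadd _ _ = some a
  rw [pcompl_pcompl]
  exact oadd_comm _ _ _ h

theorem J_le_of_mem_commutant (h : a ∈ B.commutant p) : Le (B.J p a) a := le_left_of_oadd h

theorem oadd_mem_commutant (h : oadd a b = some c) (ha : a ∈ B.commutant p)
    (hb : b ∈ B.commutant p) : c ∈ B.commutant p := by
  obtain ⟨x, y, hx, hy, hxy⟩ := oadd_oadd_oadd_comm ha hb h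
  exact B.mem_commutant_of_oadd hxy (B.oadd_le hx (B.J_le _ _) (B.J_le _ _))
    (B.oadd_le (p := B.pcompl p) hy (B.J_le _ _) (B.J_le _ _))

theorem mem_commutant_of_oadd_mem (h : oadd a x = some b) (ha : a ∈ B.commutant p)
    (hb : b ∈ B.commutant p) : x ∈ B.commutant p := by
  obtain ⟨y, z, hy, hz, hyz⟩ :=
    oadd_oadd_oadd_comm (B.J_oadd p h) (B.J_oadd (B.pcompl p) h) hb
  have hya : y = a := Option.some.inj (hy.symm.trans ha)
  subst hya
  rw [oadd_left_cancel hyz h] at hz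
  exact hz

theorem zero_mem_commutant (p : B.proj) : (0 : E) ∈ B.commutant p :=
  B.mem_commutant_of_le (zero_le' _)

theorem one_mem_commutant (p : B.proj) : (1 : E) ∈ B.commutant p :=
  B.mem_commutant_of_oadd (oadd_orthosupp _) (le_rfl' (p : E)) (le_rfl' _)

theorem orthosupp_mem_commutant (h : a ∈ B.commutant p) : orthosupp a ∈ B.commutant p :=
  B.mem_commutant_of_oadd_mem (oadd_orthosupp a) h (B.one_mem_commutant p)

theorem mackey_of_mem_commutant (h : (q : E) ∈ B.commutant p) : Mackey (p : E) (q : E) := by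
  obtain ⟨x, hx⟩ := B.J_le p (q : E)
  obtain ⟨t, ht⟩ := exists_oadd_of_le (le_rfl' (p : E)) (B.J_le (B.pcompl p) (q : E))
  obtain ⟨r, hr, hr'⟩ := oadd_assoc _ _ _ _ _ hx ht
  obtain ⟨k, hk, hk'⟩ := oadd_assoc _ _ _ _ _ (oadd_comm _ _ _ hx) ht
  obtain ⟨m, hm, hm'⟩ := oadd_assoc_symm (oadd_comm _ _ _ hk) hk'
  exact ⟨x, _, _, m, t, hm, hm', oadd_comm _ _ _ hx, oadd_comm _ _ _ h⟩

theorem mem_commutant_of_mackey (h : Mackey (p : E) a) : a ∈ B.commutant p := by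
  obtain ⟨a₁, b₁, c, s, t, h1, h2, h3, h4⟩ := h
  obtain ⟨r, hr, hr'⟩ := oadd_assoc _ _ _ _ _ (oadd_comm _ _ _ h1) h2
  rw [h3] at hr
  cases hr
  exact B.mem_commutant_of_oadd (oadd_comm _ _ _ h4) (le_right_of_oadd h3)
    (le_orthosupp_of_oadd hr')

theorem mem_commutant_symm (h : (q : E) ∈ B.commutant p) : (p : E) ∈ B.commutant q := by
  obtain ⟨a₁, b₁, c, s, t, h1, h2, h3, h4⟩ := B.mackey_of_mem_commutant h
  exact B.mem_commutant_of_mackey ⟨b₁, a₁, c, s, t, oadd_comm _ _ _ h1, h2, h4, h3⟩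

/-- The product of commuting compressions, with focus the infimum of the foci. -/
theorem exists_J_comp (h : (q : E) ∈ B.commutant p) :
    ∃ r : B.proj, (∀ a, B.J p (B.J q a) = B.J r a) ∧ (r : E) = B.J p q := by
  obtain ⟨r, hr⟩ := B.comp_of_mackey p q (B.mackey_of_mem_commutant h)
  refine ⟨r, fun a => congrFun hr a, ?_⟩
  have := congrFun hr 1
  simp only [Function.comp_apply, B.focus] at this
  exact this.symm

theorem J_coe_comm (h : (q : E) ∈ B.commutant p) : B.J p (q : E) = B.J q (p : E) := by
  have key : ∀ {p q : B.proj}, (q : E) ∈ B.commutant p → Le (B.J p (q : E)) (B.J q (p : E)) := by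
    intro p q h
    have h1 := B.J_mono q (B.J_le p (q : E))
    rwa [B.J_of_le (p := q) (B.J_le_of_mem_commutant h)] at h1
  exact (key h).antisymm (key (B.mem_commutant_symm h))

/-- Both composites belong to the base and have the same focus; members of the base are determined
by their focus. -/
theorem J_comm (h : (q : E) ∈ B.commutant p) (a : E) : B.J p (B.J q a) = B.J q (B.J p a) := by
  obtain ⟨r, hr, hr'⟩ := B.exists_J_comp h
  obtain ⟨t, ht, ht'⟩ := B.exists_J_comp (B.mem_commutant_symm h)
  have : r = t := Subtype.ext (by rw [hr', ht', B.J_coe_comm h])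
  rw [hr, ht, this]

theorem J_J_of_le (h : Le (p : E) q) (a : E) : B.J p (B.J q a) = B.J p a := by
  rw [B.J_comm (B.mem_commutant_symm (B.mem_commutant_of_le h)),
    B.J_of_le (p := q) ((B.J_le p a).trans h)]

theorem J_mem_commutant (ha : a ∈ B.commutant q) (hp : (p : E) ∈ B.commutant q) :
    B.J p a ∈ B.commutant q := by
  have h := B.J_oadd p ha
  rw [← B.J_comm hp, ← B.J_comm (B.mem_commutant_pcompl hp)] at h
  exact h

theorem isMeet_J (h : a ∈ B.commutant p) : IsMeet a p (B.J p a) := by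
  refine ⟨B.J_le_of_mem_commutant h, B.J_le p a, fun x hxa hxp => ?_⟩
  rw [← B.J_of_le hxp]
  exact B.J_mono p hxa

/-- Compressions onto orthogonal projections add up on commuting elements. -/
theorem J_oadd_J (h : oadd (p : E) (q : E) = some (r : E)) (ha : a ∈ B.commutant p) :
    oadd (B.J p a) (B.J q a) = some (B.J r a) := by
  have h1 := B.J_oadd r ha
  have hpr := le_left_of_oadd h
  rw [B.J_of_le (p := r) ((B.J_le p a).trans hpr)] at h1
  -- Applying J_r to a = J_p(a) ⊕ J_{p'}(a) leaves the term J_r J_{p'}(a); its compression has focus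
  -- r ∧ p' = q.
  have hr : (r : E) ∈ B.commutant (B.pcompl p) :=
    B.mem_commutant_pcompl (B.mem_commutant_symm (B.mem_commutant_of_le hpr))
  obtain ⟨t, ht, ht'⟩ := B.exists_J_comp (B.mem_commutant_symm hr)
  have h2 := B.J_oadd (B.pcompl p) h
  rw [B.J_pcompl_eq_zero_iff.2 (le_rfl' (p : E)), zero_oadd,
    B.J_of_le (p := B.pcompl p) (le_orthosupp_of_oadd (oadd_comm _ _ _ h))] at h2
  have : t = q := Subtype.ext (by
    rw [ht', B.J_coe_comm (B.mem_commutant_symm hr), ← Option.some.inj h2])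
  rwa [ht, this] at h1

/-- The orthosum g = (a ∧ p) ⊕ (a ∧ p') exists and lies in F. It is above a by distributivity and
below a because projections are principal. -/
theorem mem_commutant_of_isBooleanSubalgebra {F : Set E} (hFP : F ⊆ B.proj)
    (hF : IsBooleanSubalgebra F) (hp : (p : E) ∈ F) (ha : a ∈ F) : a ∈ B.commutant p := by
  obtain ⟨hS, _, hle, hcompl⟩ := hF
  let P : F := ⟨p, hp⟩
  let A : F := ⟨a, ha⟩
  have he : Le ((A ⊓ P : F) : E) p := (hle _ P).1 inf_le_right
  have hf : Le ((A ⊓ Pᶜ : F) : E) (orthosupp (p : E)) := by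
    have := (hle (A ⊓ Pᶜ) Pᶜ).1 inf_le_right
    rwa [hcompl] at this
  obtain ⟨g, hg⟩ := exists_oadd_of_le he hf
  have hgF : g ∈ F := hS.oadd_mem _ (A ⊓ P).2 _ (A ⊓ Pᶜ).2 _ hg
  have h1 : A ≤ ⟨g, hgF⟩ := by
    rw [← sup_inf_inf_compl (x := A) (y := P)]
    exact sup_le ((hle _ _).2 (le_left_of_oadd hg)) ((hle _ _).2 (le_right_of_oadd hg))
  have h2 : Le g a := B.oadd_le (p := ⟨a, hFP ha⟩) hg
    ((hle _ A).1 inf_le_left) ((hle _ A).1 inf_le_left)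
  rw [Le.antisymm (a := a) (b := g) ((hle _ _).1 h1) h2]
  exact B.mem_commutant_of_oadd hg he hf

/-- An element commutes with every projection that commutes with its commutant. -/
theorem HasBProperty.mem_commutant {B : CompressionBase E} (hB : B.HasBProperty) {r : B.proj}
    {a : E} (h : ∀ q : B.proj, a ∈ B.commutant q → (r : E) ∈ B.commutant q) :
    a ∈ B.commutant r := by
  obtain ⟨F, hFP, hF, hFc⟩ := hB a
  refine (hFc r).2 fun x hx => ?_
  -- Each x in F commutes with all of F, hence with a, so the hypothesis on r applies to x.
  exact B.mem_commutant_symm (p := ⟨x, hFP hx⟩) (h ⟨x, hFP hx⟩ ((hFc _).2 fun y hy =>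
    B.mem_commutant_of_isBooleanSubalgebra (p := ⟨x, hFP hx⟩) hFP hF hx hy))

theorem mem_bicommutant_iff {A : Set E} : p ∈ B.bicommutant A ↔
    (∀ q ∈ B.PC A, (q : E) ∈ B.commutant p) ∧ p ∈ B.PC A := by
  constructor
  · exact fun h => ⟨fun q hq => h _ (Or.inl ⟨q, hq, rfl⟩), fun a ha => h _ (Or.inr ha)⟩
  · rintro ⟨h1, h2⟩ a (⟨q, hq, rfl⟩ | ha)
    exacts [h1 q hq, h2 a ha]

theorem pcompl_mem_bicommutant {A : Set E} (h : p ∈ B.bicommutant A) :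
    B.pcompl p ∈ B.bicommutant A := fun a ha => B.mem_commutant_pcompl (h a ha)

/-! ### Positive parts and projection covers -/

theorem commute_orthosupp (a : E) : B.Commute (orthosupp a) a := by
  intro p hp q hq
  refine B.mackey_of_mem_commutant ((B.mem_bicommutant_iff.1 hp).1 q ?_)
  rintro x rfl
  exact B.orthosupp_mem_commutant ((B.mem_bicommutant_iff.1 hq).2 a rfl)

theorem pcompl_mem_PLe (h : p ∈ B.PLe a b) : B.pcompl p ∈ B.PLe b a := by
  refine ⟨?_, h.2.2, ?_⟩
  · rw [Set.pair_comm]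
    exact B.pcompl_mem_bicommutant h.1
  · rw [pcompl_pcompl]
    exact h.2.1

/-- Under J_{q'} the hypothesis becomes J_p J_{q'}(a) ⊕ J_{q'}(x) = J_p J_{q'}(b) ≤ J_p J_{q'}(a),
which forces J_{q'}(x) = 0. -/
theorem le_of_mem_PLe (hqp : (q : E) ∈ B.commutant p) (hq : q ∈ B.PLe a b)
    (h : oadd (B.J p a) x = some (B.J p b)) : Le x q := by
  have h1 := B.J_oadd (B.pcompl q) h
  have hpq := B.mem_commutant_pcompl (B.mem_commutant_symm hqp)
  obtain ⟨z, hz⟩ := B.J_mono p hq.2.2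
  rw [B.J_comm hpq, B.J_comm hpq] at h1
  obtain ⟨t, ht, ht'⟩ := oadd_assoc _ _ _ _ _ h1 hz
  rw [oadd_left_cancel ht' (oadd_zero _)] at ht
  exact B.J_pcompl_eq_zero_iff.1 (eq_zero_of_oadd_eq_zero ht)

/-- The difference `J_p(b) ⊖ J_p(a)` does not depend on `p ∈ P_≤(a, b)`. -/
theorem oadd_of_mem_PLe (hp : p ∈ B.PLe a b) (hq : q ∈ B.PLe a b)
    (h : oadd (B.J p a) x = some (B.J p b)) : oadd (B.J q a) x = some (B.J q b) := by
  have hqp : (q : E) ∈ B.commutant p :=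
    (B.mem_bicommutant_iff.1 hp.1).1 q (B.mem_bicommutant_iff.1 hq.1).2
  obtain ⟨y, hy⟩ := hq.2.1
  have h1 := B.J_oadd q h
  have h2 := B.J_oadd p hy
  rw [B.J_of_le (p := q) (B.le_of_mem_PLe hqp hq h)] at h1
  rw [B.J_of_le (B.le_of_mem_PLe (B.mem_commutant_symm hqp) hp hy),
    B.J_comm hqp, B.J_comm hqp] at h2
  rwa [oadd_left_cancel h1 h2]

theorem oadd_posPart (hp : p ∈ B.PLe a b) :
    oadd (B.J p a) (B.posPart b a) = some (B.J p b) := by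
  obtain ⟨x, hx⟩ := hp.2.1
  obtain ⟨q, hq, h⟩ := @Classical.epsilon_spec E
    (fun x => ∃ p ∈ B.PLe a b, oadd (B.J p a) x = some (B.J p b)) ⟨x, p, hp, hx⟩
  exact B.oadd_of_mem_PLe hq hp h

theorem HasProjCover.isProjCover {B : CompressionBase E} (hB : B.HasProjCover) (a : E) :
    B.IsProjCover a (B.cover a) :=
  @Classical.epsilon_spec B.proj (fun p => B.IsProjCover a p) (hB a)

theorem HasProjCover.le_cover {B : CompressionBase E} (hB : B.HasProjCover) (a : E) :
    Le a (B.cover a) := (hB.isProjCover a _).2 (le_rfl' _)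

/-- The covers of J_q(a) and J_{q'}(a) lie below q and q'. Their orthosum is a projection between a
and a°, hence equal to a°. -/
theorem HasProjCover.cover_mem_commutant {B : CompressionBase E} (hB : B.HasProjCover)
    {q : B.proj} {a : E} (h : a ∈ B.commutant q) : (B.cover a : E) ∈ B.commutant q := by
  have h1 := (hB.isProjCover (B.J q a) q).1 (B.J_le q a)
  have h2 := (hB.isProjCover (B.J (B.pcompl q) a) (B.pcompl q)).1 (B.J_le _ a)
  obtain ⟨t, ht⟩ := exists_oadd_of_le h1 h2
  have htP : t ∈ B.proj :=
    B.isSubEffectAlgebra.oadd_mem _ (B.cover _).2 _ (B.cover _).2 _ ht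
  have h3 : Le t (B.cover a) := B.oadd_le ht
    ((hB.isProjCover _ _).1 ((le_left_of_oadd h).trans (hB.le_cover a)))
    ((hB.isProjCover _ _).1 ((le_right_of_oadd h).trans (hB.le_cover a)))
  have h4 : Le a t := B.oadd_le (p := ⟨t, htP⟩) h
    ((hB.le_cover _).trans (le_left_of_oadd ht)) ((hB.le_cover _).trans (le_right_of_oadd ht))
  rw [((hB.isProjCover a ⟨t, htP⟩).1 h4).antisymm h3]
  exact B.mem_commutant_of_oadd ht h1 h2

end CompressionBase

end EffectAlgebra

namespace EffectAlgebra

theorem IsMeet.symm {E : Type*} [EffectAlgebra E] {a b m : E} (h : IsMeet a b m) :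
    IsMeet b a m := ⟨h.2.1, h.1, fun x hb ha => h.2.2 x ha hb⟩

/-- The definition evaluates the digits in ℚ; a natural numerator is needed for the parity argument.
-/
theorem dyadic_eq (w : List Bool) :
    dyadic w = ((Nat.ofDigits 2 (w.reverse.map Bool.toNat) : ℕ) : ℚ) / 2 ^ w.length := by
  rw [dyadic, Nat.coe_ofDigits, Nat.cast_ofNat]

theorem dyadic_append (w : List Bool) (i : Bool) :
    (dyadic (w ++ [i]) : ℝ) = dyadic w + i.toNat * (1 / 2) ^ (w.length + 1) := by
  simp only [dyadic_eq, List.reverse_append, List.reverse_singleton, List.singleton_append,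
    List.map_cons, Nat.ofDigits_cons, List.length_append, List.length_singleton, one_div, inv_pow]
  push_cast
  field_simp
  ring

theorem dyadic_nil : dyadic [] = 0 := by simp [dyadic_eq, Nat.ofDigits_nil]

theorem dyadic_append_false (w : List Bool) : dyadic (w ++ [false]) = dyadic w := by
  have := dyadic_append w false
  simpa using this

/-! ### The bisection step and its invariant -/

namespace CompressionBase

variable {E : Type*} [EffectAlgebra E] {B : CompressionBase E}

theorem isFunctional_comp_J {φ : E → ℝ} (hφ : IsFunctional φ) (p : B.proj) :
    IsFunctional fun a => φ (B.J p a) where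
  add h := hφ.add (B.J_oadd p h)
  nonneg _ := hφ.nonneg _

/-- This functional agrees with φ on C(p), which is how commutation is tested. -/
theorem isFunctional_J_add_J {φ : E → ℝ} (hφ : IsFunctional φ) (p : B.proj) :
    IsFunctional fun a => φ (B.J p a) + φ (B.J (B.pcompl p) a) where
  add {a b c} h := by
    have h1 := hφ.add (B.J_oadd p h)
    have h2 := hφ.add (B.J_oadd (B.pcompl p) h)
    linarith
  nonneg _ := add_nonneg (hφ.nonneg _) (hφ.nonneg _)

/-- One binary digit is extracted: r = (c - c')₊° is where it is 1 and m = u ∧ r' where it is 0. As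
seen by functionals, c is (r + x)/2 on r and z/2 on m. -/
theorem IsSpectral.step_spec (hB : B.IsSpectral) (u : B.proj) {c : E} (hc : Le c u) :
    ∃ (r m : B.proj) (x z : E), B.step ((u : E), c) true = ((r : E), x) ∧
      B.step ((u : E), c) false = ((m : E), z) ∧ oadd (m : E) (r : E) = some (u : E) ∧
      Le x r ∧ Le z m ∧
      (∀ q : B.proj, (u : E) ∈ B.commutant q → c ∈ B.commutant q →
        (r : E) ∈ B.commutant q ∧ x ∈ B.commutant q ∧
          (m : E) ∈ B.commutant q ∧ z ∈ B.commutant q) ∧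
      ∀ φ : E → ℝ, IsFunctional φ →
        2 * φ (B.J r c) = φ r + φ x ∧ 2 * φ (B.J m c) = φ z := by
  obtain ⟨p, hp⟩ := hB.1.2 _ _ (B.commute_orthosupp c)
  have hpc := B.mem_bicommutant_iff.1 hp.1
  have hcp : c ∈ B.commutant p := hpc.2 c (by simp)
  have hcp' := B.orthosupp_mem_commutant hcp
  have hx := B.oadd_posPart hp
  have hy := B.oadd_posPart (B.pcompl_mem_PLe hp)
  have hcomm : ∀ q : B.proj, c ∈ B.commutant q →
      B.posPart c (orthosupp c) ∈ B.commutant q ∧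
        B.posPart (orthosupp c) c ∈ B.commutant q := by
    intro q hq
    have hq' := B.orthosupp_mem_commutant hq
    have hpq : (p : E) ∈ B.commutant q := by
      refine B.mem_commutant_symm (hpc.1 q ?_)
      rintro a (rfl | rfl)
      exacts [hq', hq]
    have hpq' : (B.pcompl p : E) ∈ B.commutant q := B.orthosupp_mem_commutant hpq
    exact ⟨B.mem_commutant_of_oadd_mem hx (B.J_mem_commutant hq' hpq) (B.J_mem_commutant hq hpq),
      B.mem_commutant_of_oadd_mem hy (B.J_mem_commutant hq hpq') (B.J_mem_commutant hq' hpq')⟩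
  have hstep0 : B.step ((u : E), c) false = (B.nextU0 u c,
    ominus (B.nextU0 u c) (meet (B.posPart (orthosupp c) c) u)) := rfl
  have hstep1 : B.step ((u : E), c) true = (meet (u : E) (orthosupp (B.nextU0 u c)),
    meet (B.posPart c (orthosupp c)) u) := rfl
  rw [hstep0, hstep1]
  unfold nextU0
  generalize B.posPart c (orthosupp c) = x at *
  generalize B.posPart (orthosupp c) c = y at *
  have hxp : Le x p := (le_right_of_oadd hx).trans (B.J_le _ _)
  have hyp : Le y (B.pcompl p) := (le_right_of_oadd hy).trans (B.J_le _ _)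
  have hxu : Le x u :=
    ((le_right_of_oadd hx).trans (B.J_le_of_mem_commutant hcp)).trans hc
  have hxr := hB.2.le_cover x
  have hrp := (hB.2.isProjCover x p).1 hxp
  have hru := (hB.2.isProjCover x u).1 hxu
  have hrcomm : ∀ q : B.proj, c ∈ B.commutant q → (B.cover x : E) ∈ B.commutant q :=
    fun q hq => hB.2.cover_mem_commutant (hcomm q hq).1
  generalize B.cover x = r at *
  have hyr : Le y (B.pcompl r) := hyp.trans (orthosupp_antitone hrp)
  have hur : (u : E) ∈ B.commutant r := B.mem_commutant_symm (B.mem_commutant_of_le hru)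
  have hru' : B.J r (u : E) = r := by
    rw [B.J_coe_comm hur, B.J_of_le hru]
  obtain ⟨m, -, hm⟩ := B.exists_J_comp (B.mem_commutant_pcompl hur)
  have hrm : oadd (r : E) (m : E) = some (u : E) := by
    have h : oadd (B.J r (u : E)) (B.J (B.pcompl r) (u : E)) = some (u : E) := hur
    rwa [hru', ← hm] at h
  have hmeet : IsMeet (u : E) (B.pcompl r) m := by
    rw [hm]
    exact B.isMeet_J (B.mem_commutant_pcompl hur)
  have hmeet' : IsMeet (u : E) (B.pcompl m) r := by
    refine ⟨hru, le_orthosupp_of_oadd hrm, fun v hvu hvm => ?_⟩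
    have h1 := B.J_oadd (B.pcompl m) hrm
    rw [B.J_of_le (p := B.pcompl m) (le_orthosupp_of_oadd hrm),
      B.J_pcompl_eq_zero_iff.2 (le_rfl' (m : E)), oadd_zero] at h1
    rw [Option.some.inj h1, ← B.J_of_le hvm]
    exact B.J_mono _ hvu
  have hyu : y ∈ B.commutant u := (hcomm u (B.mem_commutant_of_le hc)).2
  -- y ≤ p' ≤ r', so J_u(y) = y ∧ u lies below u ∧ r' = m and the difference z is defined.
  have hJym : Le (B.J u y) m := hmeet.2.2 _ (B.J_le _ _)
    ((B.J_le_of_mem_commutant hyu).trans hyr)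
  obtain ⟨z, hz⟩ := hJym
  have hrm0 : meet (orthosupp (r : E)) (u : E) = m := hmeet.symm.meet_eq
  have hum : meet (u : E) (orthosupp (m : E)) = r := hmeet'.meet_eq
  have hxu' : meet x (u : E) = x := IsMeet.meet_eq ⟨le_rfl' _, hxu, fun _ h _ => h⟩
  have hyu' : meet y (u : E) = B.J u y := (B.isMeet_J hyu).meet_eq
  refine ⟨r, m, x, z, ?_, ?_, oadd_comm _ _ _ hrm, hxr, le_right_of_oadd hz, ?_, ?_⟩
  · rw [hrm0, hum, hxu']
  · rw [hrm0, hyu', ominus_eq hz]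
  · intro q hqu hqc
    have hqr := hrcomm q hqc
    have hqm := B.mem_commutant_of_oadd_mem hrm hqr hqu
    exact ⟨hqr, (hcomm q hqc).1, hqm,
      B.mem_commutant_of_oadd_mem hz (B.J_mem_commutant (hcomm q hqc).2 hqu) hqm⟩
  · intro φ hφ
    have hone : ∀ s : B.proj, φ (B.J s c) + φ (B.J s (orthosupp c)) = φ s := fun s => by
      rw [hφ.add (B.J_oadd s (oadd_orthosupp c)), B.focus]
    constructor
    -- As r ≤ p, this becomes J_r(c') ⊕ x = J_r(c), to be combined with J_r(c) ⊕ J_r(c') = r.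
    · have h1 := B.J_oadd r hx
      rw [B.J_J_of_le hrp, B.J_J_of_le hrp, B.J_of_le hxr] at h1
      linarith [hφ.add h1, hone r]
    -- J_m kills x and sends y to J_u(y) = m ⊖ z, so φ(J_m(c')) - φ(J_m(c)) = φ(m) - φ(z).
    · have h1 := hφ.add (B.J_oadd m hx)
      have h2 := hφ.add (B.J_oadd m hy)
      have h3 := hφ.add (B.J_oadd m hcp)
      have h4 := hφ.add (B.J_oadd m hcp')
      rw [B.J_eq_zero_iff.2 (hxr.trans (le_orthosupp_of_oadd hrm)), hφ.map_zero] at h1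
      rw [← B.J_J_of_le (le_right_of_oadd hrm) y, B.J_of_le (le_left_of_oadd hz)] at h2
      linarith [hφ.add hz, hone m]

theorem family_append (B : CompressionBase E) (a : E) (w : List Bool) (i : Bool) :
    B.family a (w ++ [i]) = B.step (B.family a w) i := by
  simp [family]

theorem IsSpectral.family_spec (hB : B.IsSpectral) (a : E) (w : List Bool) :
    ∃ (u : B.proj) (c : E), B.family a w = ((u : E), c) ∧ Le c u ∧
      (∀ q : B.proj, a ∈ B.commutant q → (u : E) ∈ B.commutant q ∧ c ∈ B.commutant q) ∧
      ∀ φ : E → ℝ, IsFunctional φ →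
        φ (B.J u a) = dyadic w * φ u + (1 / 2) ^ w.length * φ c := by
  induction w using List.reverseRecOn with
  | nil =>
    refine ⟨B.cover a, a, rfl, hB.2.le_cover a,
      fun q hq => ⟨hB.2.cover_mem_commutant hq, hq⟩, fun φ _ => ?_⟩
    rw [B.J_of_le (hB.2.le_cover a), dyadic_nil]
    simp
  | append_singleton w i ih =>
    obtain ⟨u, c, huc, hcu, hcomm, hval⟩ := ih
    obtain ⟨r, m, x, z, h1, h0, hmr, hxr, hzm, hcomm', hval'⟩ := hB.step_spec u hcu
    -- The invariant for all functionals localizes: apply it to φ ∘ J_s.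
    have key : ∀ s : B.proj, Le (s : E) u → ∀ φ : E → ℝ, IsFunctional φ →
        φ (B.J s a) = dyadic w * φ s + (1 / 2) ^ w.length * φ (B.J s c) := by
      intro s hs φ hφ
      have h := hval _ (isFunctional_comp_J hφ s)
      rwa [B.J_J_of_le hs, B.J_coe_comm (B.mem_commutant_symm (B.mem_commutant_of_le hs)),
        B.J_of_le hs] at h
    cases i with
    | false =>
      refine ⟨m, z, by rw [family_append, huc, h0], hzm, fun q hq => ?_, fun φ hφ => ?_⟩
      · obtain ⟨-, -, h⟩ := hcomm' q (hcomm q hq).1 (hcomm q hq).2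
        exact h
      · rw [key m (le_left_of_oadd hmr) φ hφ, dyadic_append_false, ← (hval' φ hφ).2,
          List.length_append, List.length_singleton, pow_succ]
        ring
    | true =>
      refine ⟨r, x, by rw [family_append, huc, h1], hxr, fun q hq => ?_, fun φ hφ => ?_⟩
      · obtain ⟨h, h', -⟩ := hcomm' q (hcomm q hq).1 (hcomm q hq).2
        exact ⟨h, h'⟩
      · rw [key r (le_right_of_oadd hmr) φ hφ, dyadic_append, Bool.toNat_true,
          List.length_append, List.length_singleton, pow_succ]
        have := (hval' φ hφ).1
        have h2 : φ (B.J r c) = (φ r + φ x) / 2 := by linarith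
        rw [h2]
        push_cast
        ring

theorem IsSpectral.u_mem (hB : B.IsSpectral) (a : E) (w : List Bool) : B.u a w ∈ B.proj := by
  obtain ⟨u, c, huc, -⟩ := hB.family_spec a w
  rw [CompressionBase.u, huc]
  exact u.2

theorem IsSpectral.u_mem_commutant (hB : B.IsSpectral) {q : B.proj} {a : E}
    (h : a ∈ B.commutant q) (w : List Bool) : B.u a w ∈ B.commutant q := by
  obtain ⟨u, c, huc, -, hcomm, -⟩ := hB.family_spec a w
  rw [CompressionBase.u, huc]
  exact (hcomm q h).1

theorem IsSpectral.u_oadd_u (hB : B.IsSpectral) (a : E) (w : List Bool) :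
    oadd (B.u a (w ++ [false])) (B.u a (w ++ [true])) = some (B.u a w) := by
  obtain ⟨u, c, huc, hcu, -⟩ := hB.family_spec a w
  obtain ⟨r, m, x, z, h1, h0, hmr, -⟩ := hB.step_spec u hcu
  simp only [CompressionBase.u, family_append, huc, h1, h0]
  exact hmr

theorem IsSpectral.mem_commutant_u (hB : B.IsSpectral) (a : E) (w : List Bool) :
    a ∈ B.commutant ⟨B.u a w, hB.u_mem a w⟩ :=
  hB.1.1.mem_commutant fun _ hq => hB.u_mem_commutant hq w

/-! ### Dyadic approximation of functionals -/

theorem strings_sum_succ (f : List Bool → ℝ) (n : ℕ) :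
    ((strings (n + 1)).map f).sum =
      ((strings n).map fun w => f (w ++ [false]) + f (w ++ [true])).sum := by
  rw [strings]
  induction strings n with
  | nil => rfl
  | cons w l ih =>
    rw [List.flatMap_cons, List.map_append, List.sum_append, ih]
    simp

theorem length_of_mem_strings {n : ℕ} : ∀ {w : List Bool}, w ∈ strings n → w.length = n := by
  induction n with
  | zero => simp [strings]
  | succ n ih =>
    intro w hw
    simp only [strings, List.mem_flatMap, List.mem_cons, List.not_mem_nil, or_false] at hw
    obtain ⟨v, hv, rfl | rfl⟩ := hw <;> simp [ih hv]

theorem IsSpectral.osum_u (hB : B.IsSpectral) (a : E) (n : ℕ) :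
    osum ((strings n).map (B.u a)) = some (B.cover a : E) := by
  induction n with
  | zero => exact osum_cons_eq_some.2 ⟨0, rfl, oadd_zero _⟩
  | succ n ih =>
    have := osum_flatMap_pair (hB.u_oadd_u a) (strings n) ih
    rw [strings, List.map_flatMap]
    exact this

theorem IsSpectral.sum_u (hB : B.IsSpectral) {φ : E → ℝ} (hφ : IsFunctional φ) (a : E) (n : ℕ) :
    ((strings n).map fun w => φ (B.u a w)).sum = φ (B.cover a) := by
  rw [hφ.map_osum _ (hB.osum_u a n), List.map_map]
  rfl

theorem IsSpectral.sum_J_u (hB : B.IsSpectral) {φ : E → ℝ} (hφ : IsFunctional φ) (a : E)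
    (n : ℕ) : ((strings n).map fun w => φ (B.J ⟨B.u a w, hB.u_mem a w⟩ a)).sum = φ a := by
  induction n with
  | zero =>
    have : B.J ⟨B.u a [], hB.u_mem a []⟩ a = a := B.J_of_le (hB.2.le_cover a)
    simp [strings, this]
  | succ n ih =>
    rw [strings_sum_succ, ← ih]
    congr 2
    funext w
    exact hφ.add (B.J_oadd_J (hB.u_oadd_u a w) (hB.mem_commutant_u a _))

/-- A functional is approximated by its values on the spectral projections. -/
theorem IsSpectral.functional_bounds (hB : B.IsSpectral) {φ : E → ℝ} (hφ : IsFunctional φ)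
    (a : E) (n : ℕ) :
    ((strings n).map fun w => (dyadic w : ℝ) * φ (B.u a w)).sum ≤ φ a ∧
      φ a ≤ ((strings n).map fun w => (dyadic w : ℝ) * φ (B.u a w)).sum +
        (1 / 2) ^ n * φ (B.cover a) := by
  have key : ∀ w ∈ strings n, (dyadic w : ℝ) * φ (B.u a w) ≤
      φ (B.J ⟨B.u a w, hB.u_mem a w⟩ a) ∧ φ (B.J ⟨B.u a w, hB.u_mem a w⟩ a) ≤
        (dyadic w : ℝ) * φ (B.u a w) + (1 / 2) ^ n * φ (B.u a w) := by
    intro w hw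
    obtain ⟨u, c, huc, hcu, -, hval⟩ := hB.family_spec a w
    have hu : (⟨B.u a w, hB.u_mem a w⟩ : B.proj) = u :=
      Subtype.ext (by simp [CompressionBase.u, huc])
    have hu' : B.u a w = u := congrArg Subtype.val hu
    rw [hu, hval φ hφ, hu', length_of_mem_strings hw]
    have hn : (0 : ℝ) ≤ (1 / 2) ^ n := by positivity
    exact ⟨le_add_of_nonneg_right (mul_nonneg hn (hφ.nonneg c)),
      add_le_add_right (mul_le_mul_of_nonneg_left (hφ.mono hcu) hn) _⟩
  rw [← hB.sum_u hφ a n, ← List.sum_map_mul_left, ← List.sum_map_add, ← hB.sum_J_u hφ a n]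
  exact ⟨List.sum_le_sum fun w hw => (key w hw).1, List.sum_le_sum fun w hw => (key w hw).2⟩

/-- Both sides have the same dyadic sums and the same error bound 2^{-n} φ(a°), which tends to 0. -/
theorem IsSpectral.functional_eq (hB : B.IsSpectral) {φ ψ : E → ℝ} (hφ : IsFunctional φ)
    (hψ : IsFunctional ψ) {a b : E} (h : ∀ w, φ (B.u a w) = ψ (B.u b w)) : φ a = ψ b := by
  have hbound : ∀ n : ℕ, |φ a - ψ b| ≤ (1 / 2) ^ n * φ (B.cover a) := by
    intro n
    have h1 := hB.functional_bounds hφ a n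
    have h2 := hB.functional_bounds hψ b n
    have h3 : φ (B.cover a) = ψ (B.cover b) := h []
    simp only [← h, ← h3] at h2
    rw [abs_le]
    constructor <;> linarith [h1.1, h1.2, h2.1, h2.2]
  have hlim : Filter.Tendsto (fun n : ℕ => (1 / 2 : ℝ) ^ n * φ (B.cover a)) Filter.atTop
      (nhds 0) := by
    simpa using (tendsto_pow_atTop_nhds_zero_of_lt_one (r := (1 / 2 : ℝ)) (by norm_num)
      (by norm_num)).mul_const (φ (B.cover a))
  have := ge_of_tendsto' hlim hbound
  exact sub_eq_zero.1 (abs_eq_zero.1 (this.antisymm (abs_nonneg _)))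

end CompressionBase

end EffectAlgebra

namespace EffectAlgebra

/-! ### Coding and lexicographic order of binary strings -/

theorem eq_of_odd_mul_two_pow_eq {k l : ℕ} : ∀ {i j : ℕ},
    (2 * k + 1) * 2 ^ i = (2 * l + 1) * 2 ^ j → i = j ∧ k = l
  | 0, 0, h => by omega
  | 0, j + 1, h => by
    rw [pow_succ, ← mul_assoc] at h
    omega
  | i + 1, 0, h => by
    rw [pow_succ, ← mul_assoc] at h
    omega
  | i + 1, j + 1, h => by
    rw [pow_succ, pow_succ, ← mul_assoc, ← mul_assoc] at h
    obtain ⟨h1, h2⟩ := eq_of_odd_mul_two_pow_eq (k := k) (l := l) (i := i) (j := j) (by omega)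
    exact ⟨by rw [h1], h2⟩

theorem dyadic_append_true (w : List Bool) : dyadic (w ++ [true]) =
    ((2 * Nat.ofDigits 2 (w.reverse.map Bool.toNat) + 1 : ℕ) : ℚ) / 2 ^ (w.length + 1) := by
  simp only [dyadic_eq, List.reverse_append, List.reverse_singleton, List.singleton_append,
    List.map_cons, Nat.ofDigits_cons, List.length_append, List.length_singleton, Bool.toNat_true]
  rw [add_comm (1 : ℕ)]

theorem dyadic_append_true_ne_zero (w : List Bool) : dyadic (w ++ [true]) ≠ 0 := by
  rw [dyadic_append_true]
  positivity

/-- λ(w1) has an odd numerator over 2^{l(w)+1}, so it determines length and digits. Hence the string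
chosen in `specProj` is the intended one. -/
theorem dyadic_append_true_injective {v w : List Bool}
    (h : dyadic (v ++ [true]) = dyadic (w ++ [true])) : v = w := by
  rw [dyadic_append_true, dyadic_append_true, div_eq_div_iff (by positivity) (by positivity)] at h
  obtain ⟨h1, h2⟩ := eq_of_odd_mul_two_pow_eq (by exact_mod_cast h)
  have h3 : ∀ u : List Bool, ∀ l ∈ u.reverse.map Bool.toNat, l < 2 := by
    intro u l hl
    obtain ⟨b, -, rfl⟩ := List.mem_map.1 hl
    exact Bool.toNat_lt b
  have h4 := Nat.ofDigits_inj_of_len_eq one_lt_two (by simp; omega) (h3 v) (h3 w) h2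
  have hinj : Function.Injective Bool.toNat := by decide
  exact List.reverse_injective (List.map_injective_iff.2 hinj h4)

theorem append_singleton_lt_iff {i j : Bool} : ∀ {v w : List Bool}, v.length = w.length →
    (v ++ [i] < w ++ [j] ↔ v < w ∨ v = w ∧ i < j)
  | [], [], _ => by simp [List.cons_lt_cons_iff]
  | x :: v, y :: w, h => by
    rw [List.cons_append, List.cons_append, List.cons_lt_cons_iff, List.cons_lt_cons_iff,
      append_singleton_lt_iff (by simpa using h), List.cons.injEq]
    tauto

theorem append_singleton_le_iff {i : Bool} {v w : List Bool} (h : v.length = w.length) :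
    v ++ [i] ≤ w ++ [false] ↔ v ++ [i] < w ++ [true] := by
  rw [← not_lt, append_singleton_lt_iff h, append_singleton_lt_iff h.symm]
  rcases lt_trichotomy v w with hvw | rfl | hvw
  · simp [hvw, hvw.not_gt, hvw.ne']
  · cases i <;> simp
  · simp [hvw, hvw.not_gt, hvw.ne']

theorem sum_map_filter {α : Type*} (f : α → ℝ) (p : α → Bool) (l : List α) :
    ((l.filter p).map f).sum = (l.map fun v => if p v then f v else 0).sum := by
  induction l with
  | nil => rfl
  | cons x l ih =>
    rw [List.filter_cons, List.map_cons, List.sum_cons, ← ih]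
    split_ifs <;> simp

/-! ### Recovering the u_w from the spectral resolution -/

namespace CompressionBase

variable {E : Type*} [EffectAlgebra E] {B : CompressionBase E}

theorem strings_sum_ite_eq (w : List Bool) (x : ℝ) :
    ((strings w.length).map fun v => if v = w then x else 0).sum = x := by
  induction w using List.reverseRecOn with
  | nil => simp [strings]
  | append_singleton w i ih =>
    rw [List.length_append, List.length_singleton, strings_sum_succ]
    refine Eq.trans ?_ ih
    congr 2
    funext v
    cases i <;> by_cases hv : v = w <;> simp [hv]

theorem specProj_zero (B : CompressionBase E) (a : E) :
    B.specProj a 0 = orthosupp (B.cover a : E) := if_pos rfl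

theorem specProj_dyadic (B : CompressionBase E) (a : E) (w : List Bool) :
    B.specProj a (dyadic (w ++ [true])) = B.specSum a w := by
  have h : ∃ v : List Bool, dyadic (w ++ [true]) = dyadic (v ++ [true]) := ⟨w, rfl⟩
  rw [specProj, if_neg (dyadic_append_true_ne_zero w), dif_pos h]
  exact congrArg (B.specSum a) (dyadic_append_true_injective h.choose_spec).symm

theorem osum_mem_commutant {q : B.proj} {l : List E} (h : ∀ x ∈ l, x ∈ B.commutant q) :
    ∀ {s : E}, osum l = some s → s ∈ B.commutant q := by
  induction l with
  | nil =>
    rintro s ⟨⟩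
    exact B.zero_mem_commutant q
  | cons x l ih =>
    intro s hs
    obtain ⟨t, ht, hts⟩ := osum_cons_eq_some.1 hs
    exact B.oadd_mem_commutant hts (h x (by simp)) (ih (fun y hy => h y (by simp [hy])) ht)

theorem IsSpectral.specProj_mem_commutant (hB : B.IsSpectral) {q : B.proj} {a : E}
    (h : a ∈ B.commutant q) (t : ℚ) : B.specProj a t ∈ B.commutant q := by
  have h0 : orthosupp (B.cover a : E) ∈ B.commutant q :=
    B.orthosupp_mem_commutant (hB.2.cover_mem_commutant h)
  unfold specProj
  split_ifs with h1 h2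
  · exact h0
  · unfold specSum
    generalize hl : osum (E := E) _ = o
    cases o with
    -- The default value 0 commutes with q, so existence of the sum is not needed here.
    | none => exact B.zero_mem_commutant q
    | some s =>
      refine osum_mem_commutant ?_ hl
      intro x hx
      rcases List.mem_cons.1 hx with rfl | hx
      · exact h0
      · obtain ⟨v, -, rfl⟩ := List.mem_map.1 hx
        exact hB.u_mem_commutant h v
  · exact B.one_mem_commutant q

/-- The sum of the values of a functional on `u_v`, over the strings `v < w` of length `l(w)`. -/
noncomputable def lowerSum (B : CompressionBase E) (φ : E → ℝ) (a : E) (w : List Bool) : ℝ :=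
  ((strings w.length).map fun v => if v < w then φ (B.u a v) else 0).sum

theorem lowerSum_nil (φ : E → ℝ) (a : E) : B.lowerSum φ a [] = 0 := by
  simp [lowerSum, strings]

theorem IsSpectral.lowerSum_append_false (hB : B.IsSpectral) {φ : E → ℝ} (hφ : IsFunctional φ)
    (a : E) (w : List Bool) : B.lowerSum φ a (w ++ [false]) = B.lowerSum φ a w := by
  rw [lowerSum, lowerSum, List.length_append, List.length_singleton, strings_sum_succ]
  refine congrArg _ (List.map_congr_left fun v hv => ?_)
  have hl := length_of_mem_strings hv
  simp only [append_singleton_lt_iff hl]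
  rw [← hφ.add (hB.u_oadd_u a v)]
  by_cases h : v < w <;> simp [h]

/-- Below w1 lie both children of each v < w, whose values recombine to φ(u_v), and the single extra
string w0. -/
theorem IsSpectral.lowerSum_append_true (hB : B.IsSpectral) {φ : E → ℝ} (hφ : IsFunctional φ)
    (a : E) (w : List Bool) : B.lowerSum φ a (w ++ [true]) =
      B.lowerSum φ a w + φ (B.u a (w ++ [false])) := by
  rw [lowerSum, lowerSum, List.length_append, List.length_singleton, strings_sum_succ,
    ← strings_sum_ite_eq w (φ (B.u a (w ++ [false]))), ← List.sum_map_add]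
  refine congrArg _ (List.map_congr_left fun v hv => ?_)
  have hl := length_of_mem_strings hv
  simp only [append_singleton_lt_iff hl]
  rw [← hφ.add (hB.u_oadd_u a v)]
  by_cases h : v < w
  · simp [h, h.ne]
  · by_cases h' : v = w
    · subst h'
      simp
    · simp [h, h']

theorem IsSpectral.map_specSum (hB : B.IsSpectral) {φ : E → ℝ} (hφ : IsFunctional φ)
    (a : E) (w : List Bool) :
    φ (B.specSum a w) = φ (orthosupp (B.cover a)) + B.lowerSum φ a (w ++ [true]) := by
  -- The sum over all strings exists, so the sublist in `specSum` has a sum and its default is not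
  -- used.
  have hfull : osum (orthosupp (B.cover a : E) :: (strings (w.length + 1)).map (B.u a)) = some 1 :=
    osum_cons_eq_some.2 ⟨_, hB.osum_u a _, oadd_comm _ _ _ (oadd_orthosupp _)⟩
  obtain ⟨s, hs, -⟩ := osum_sublist (List.Sublist.cons_cons _ ((List.filter_sublist
    (p := fun v => decide (v ≤ w ++ [false]))).map (B.u a))) hfull
  have h1 : B.specSum a w = s := by
    rw [specSum, hs]
    rfl
  rw [h1, hφ.map_osum _ hs, List.map_cons, List.sum_cons, List.map_map, sum_map_filter, lowerSum,
    List.length_append, List.length_singleton, strings_sum_succ, strings_sum_succ]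
  refine congrArg _ (congrArg _ (List.map_congr_left fun v hv => ?_))
  have hl := length_of_mem_strings hv
  simp only [decide_eq_true_eq, append_singleton_le_iff hl, Function.comp_apply]

/-- The resolution fixes the lower sums L at strings w1. Then φ(u_{w0}) = L(w1) - L(w) and φ(u_{w1})
= φ(u_w) - φ(u_{w0}), so the induction carries L(w) along with φ(u_w). -/
theorem IsSpectral.map_u_eq (hB : B.IsSpectral) {φ ψ : E → ℝ} (hφ : IsFunctional φ)
    (hψ : IsFunctional ψ) {a b : E} (h1 : φ 1 = ψ 1)
    (h : ∀ w, φ (B.specProj a (dyadic w)) = ψ (B.specProj b (dyadic w))) (w : List Bool) :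
    φ (B.u a w) = ψ (B.u b w) := by
  have h0 : φ (orthosupp (B.cover a)) = ψ (orthosupp (B.cover b)) := by
    rw [← specProj_zero, ← specProj_zero, ← dyadic_nil]
    exact h []
  have hsum : ∀ w, B.lowerSum φ a (w ++ [true]) = B.lowerSum ψ b (w ++ [true]) := by
    intro w
    have := h (w ++ [true])
    rw [specProj_dyadic, specProj_dyadic, hB.map_specSum hφ, hB.map_specSum hψ, h0] at this
    exact add_left_cancel this
  suffices h' : φ (B.u a w) = ψ (B.u b w) ∧ B.lowerSum φ a w = B.lowerSum ψ b w from h'.1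
  induction w using List.reverseRecOn with
  | nil =>
    refine ⟨?_, by rw [lowerSum_nil, lowerSum_nil]⟩
    have h2 := hφ.add (oadd_orthosupp (B.cover a : E))
    have h3 := hψ.add (oadd_orthosupp (B.cover b : E))
    change φ (B.cover a) = ψ (B.cover b)
    linarith
  | append_singleton w i ih =>
    have h2 := hsum w
    rw [hB.lowerSum_append_true hφ, hB.lowerSum_append_true hψ, ih.2] at h2
    have h3 := add_left_cancel h2
    cases i with
    | false =>
      exact ⟨h3, by rw [hB.lowerSum_append_false hφ, hB.lowerSum_append_false hψ, ih.2]⟩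
    | true =>
      refine ⟨?_, hsum w⟩
      linarith [hφ.add (hB.u_oadd_u a w), hψ.add (hB.u_oadd_u b w), ih.1]

theorem IsSpectral.functional_eq_of_specProj (hB : B.IsSpectral) {φ ψ : E → ℝ}
    (hφ : IsFunctional φ) (hψ : IsFunctional ψ) {a b : E} (h1 : φ 1 = ψ 1)
    (h : ∀ w, φ (B.specProj a (dyadic w)) = ψ (B.specProj b (dyadic w))) : φ a = ψ b :=
  hB.functional_eq hφ hψ (hB.map_u_eq hφ hψ h1 h)

end CompressionBase

end EffectAlgebra

theorem mainTheorem6 {E : Type*} [EffectAlgebra E] (B : EffectAlgebra.CompressionBase E)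
    (hB : B.IsSpectral) (S : Set (EffectAlgebra.State E)) (hS : EffectAlgebra.IsSeparating S) :
    (∀ (q : B.proj) (a : E),
      a ∈ B.commutant q ↔
        ∀ w : List Bool, B.specProj a (EffectAlgebra.dyadic w) ∈ B.commutant q) ∧
    (∀ a b : E,
      (∀ w : List Bool,
        B.specProj a (EffectAlgebra.dyadic w) = B.specProj b (EffectAlgebra.dyadic w)) →
      a = b) := by
  refine ⟨fun q a => ⟨fun h w => hB.specProj_mem_commutant h _, fun h => ?_⟩, fun a b h => ?_⟩
  -- The orthosum c of the two compressed parts always exists; the states show that c = a.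
  · obtain ⟨c, hc⟩ := EffectAlgebra.exists_oadd_of_le (B.J_le q a) (B.J_le (B.pcompl q) a)
    have hca : c = a := by
      refine hS c a fun s _ => Subtype.ext ?_
      have hs := s.isFunctional
      rw [← hs.add hc]
      refine hB.functional_eq_of_specProj
        (EffectAlgebra.CompressionBase.isFunctional_J_add_J hs q) hs ?_ fun w => hs.add (h w)
      exact hs.add (B.one_mem_commutant q)
    rwa [hca] at hc
  · refine hS a b fun s _ => Subtype.ext ?_
    have hs := s.isFunctional
    exact hB.functional_eq_of_specProj hs hs rfl fun w => by rw [h w]
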